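/- **Setting.** Let $n\in\{2,3,4\}$, let $\Omega\subset\mathbb R^n$ be a bounded open set (in particular, any bounded Lipschitz domain), and let $\nu>0$. Let $H^1_0(\Omega)^n$ be the closure of $C_c^\infty(\Omega)^n$ in the norm $(\|u\|_{L_2}^2+\|\nabla u\|_{L_2}^2)^{1/2}$, let $H^{-1}(\Omega)^n$ be its dual, and put $\mathscr U:=H^1_0(\Omega)^n\times L_2(\Omega)/\mathbb R$, where $L_2(\Omega)/\mathbb R$ is identified with the functions of mean zero. For $f\in H^{-1}(\Omega)^n$ and $g\in L_2(\Omega)/\mathbb R$, the (rescaled) stationary Navier–Stokes operator $G:\mathscr U\to\mathscr U'$ is $$G(u,p)(v,q)=\int_\Omega \nabla u:\nabla v-p\,\mathrm{div}\,v+\nu^{-3/2}(u\cdot\nabla)u\cdot v+q\,(\mathrm{div}\,u-g)\,dx-f(v).$$ A bounded linear map $A$ is called a *homeomorphism onto its range* if $r\|v\|\le\|Av\|\le R\|v\|$ for all $v$, for some $r,R>0$. A map $H$ between Hilbert spaces is *well-posed* at $x$ if $H(x)=0$, $H$ is twice continuously Fréchet differentiable near $x$, and $DH(x)$ is a homeomorphism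 onto its range. For $Q:X\to\mathbb R$ on a Hilbert space $X$, the normal equations $DQ=0$ are *well-posed* at $x$ if $Q$ is differentiable near $x$, $DQ(x)=0$, $DQ$ is continuously Fréchet differentiable near $x$, $D^2Q(x):X\to X'$ is symmetric, coercive and boundedly invertible, and $x$ is the only zero of $DQ$ in some neighbourhood of $x$. *Velocity–pressure–velocity gradient.* On $\mathscr U\times L_2(\Omega)^{n^2}$ let $M(u,p,\theta)(v)=\int_\Omega\theta:\nabla v-p\,\mathrm{div}\,v+\nu^{-3/2}(u\cdot\nabla)u\cdot v\,dx-f(v)$, $$H(u,p,\theta)=\Big((v,q)\mapsto M(u,p,\theta)(v)+\int_\Omega q(\mathrm{div}\,u-g)\,dx,\ \theta-\nabla u\Big),$$ $$Q(u,p,\theta)=\tfrac12\big(\|M(u,p,\theta)\|_{H^{-1}}^2+\|\mathrm{div}\,u-g\|_{L_2}^2+\|\theta-\nabla u\|^2_{L_2}\big).$$ *Velocity–pressure–vorticity.* For $n\in\{2,3\}$, with $\mathrm{curl}\,u\in L_2(\Omega)^{2n-3}$, on $\mathscr U\times L_2(\Omega)^{2n-3}$ let $N(u,p,\omega)(v)=\int_\Omega\omega\cdot\mathrm{curl}\,v-p\,\mathrm{div}\,v+\nu^{-3/2}(u\cdot\nabla)u\cdot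 v\,dx-f(v)$, $B(u)(v)=\int_\Omega\mathrm{div}\,u\,\mathrm{div}\,v\,dx$, $$H_1(u,p,\omega)=\Big((v,q)\mapsto N(u,p,\omega)(v)+B(u)(v)+\int_\Omega q(\mathrm{div}\,u-g)\,dx,\ \omega-\mathrm{curl}\,u\Big),$$ $$Q_1(u,p,\omega)=\tfrac12\big(\|N(u,p,\omega)+B(u)\|_{H^{-1}}^2+\|\mathrm{div}\,u-g\|_{L_2}^2+\|\omega-\mathrm{curl}\,u\|_{L_2}^2\big),$$ $$H_2(u,p,\omega)=\Big((v,q)\mapsto N(u,p,\omega)(v)+\int_\Omega q\,\mathrm{div}\,u\,dx,\ \omega-\mathrm{curl}\,u\Big),$$ $$Q_2(u,p,\omega)=\tfrac12\big(\|N(u,p,\omega)\|_{H^{-1}}^2+\|\mathrm{div}\,u\|_{L_2}^2+\|\omega-\mathrm{curl}\,u\|_{L_2}^2\big).$$ **Theorem.** (A) ($n\in\{2,3,4\}$, any $g$.) $Q=\frac12\|H\|^2_{\mathscr U'\times L_2}$, and $H(u,p,\theta)=0$ if and only if $G(u,p)=0$ and $\theta=\nabla u$. If $G(u,p)=0$ and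 $DG(u,p)$ is a homeomorphism onto its range, then, at $x=(u,p,\nabla u)$, $H$ is well-posed, $Q(y)\eqsim\|y-x\|^2$ for $y$ near $x$, and the normal equations $DQ=0$ are well-posed. (B) ($n\in\{2,3\}$, any $g$.) The statements of (A) hold with $(H,Q,\theta,\nabla)$ replaced by $(H_1,Q_1,\omega,\mathrm{curl})$. (C) ($n\in\{2,3\}$, $g=0$.) There is a constant $C>0$, depending only on $n$, such that $Q_1\le C\,Q_2$ and $Q_2\le C\,Q_1$ on all of $\mathscr U\times L_2(\Omega)^{2n-3}$. Moreover $Q_2=\frac12\|H_2\|^2_{\mathscr U'\times L_2}$, and $H_2(u,p,\omega)=0$ if and only if $G(u,p)=0$ and $\omega=\mathrm{curl}\,u$. If $G(u,p)=0$ and $DG(u,p)$ is a homeomorphism onto its range, then, at $x=(u,p,\mathrm{curl}\,u)$, $H_2$ is well-posed, $Q_2(y)\eqsim\|y-x\|^2$ for $y$ near $x$, and the normal equations $DQ_2=0$ are well-posed. -/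

import Mathlib

open MeasureTheory Filter Topology InnerProductSpace
open scoped ContDiff ENNReal NNReal

namespace NavierStokes

noncomputable section

/-- The Euclidean space `ℝⁿ`. -/
abbrev Vec (n : ℕ) : Type := EuclideanSpace ℝ (Fin n)

/-- `n × n` matrices with the Frobenius inner product `A : B = ∑ i j, A i j * B i j`. -/
abbrev Mat (n : ℕ) : Type := EuclideanSpace ℝ (Fin n × Fin n)

/-- A bounded open set `Ω ⊆ ℝⁿ` with `n ∈ {2, 3, 4}`. -/
structure FlowDomain (n : ℕ) where
  carrier : Set (Vec n)
  isOpen : IsOpen carrier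
  isBounded : Bornology.IsBounded carrier
  two_le : 2 ≤ n
  le_four : n ≤ 4

variable {n : ℕ}

/-- Lebesgue measure on `Ω`. -/
abbrev vol (Ω : FlowDomain n) : Measure (Vec n) := volume.restrict Ω.carrier

instance (Ω : FlowDomain n) : IsFiniteMeasure (vol Ω) :=
  isFiniteMeasure_restrict.2 Ω.isBounded.measure_lt_top.ne

/-- `L₂(Ω; F)`. -/
abbrev L2 (Ω : FlowDomain n) (F : Type) [NormedAddCommGroup F] : Type := Lp F 2 (vol Ω)

/-- The matrix of a linear map `ℝⁿ → ℝⁿ`, with `(i, j)` entry `(A eⱼ)ᵢ`. -/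
def matOf : (Vec n →L[ℝ] Vec n) →ₗ[ℝ] Mat n where
  toFun A := WithLp.toLp 2 fun ij => A (EuclideanSpace.single ij.2 1) ij.1
  map_add' A B := by ext; simp
  map_smul' c A := by ext; simp

/-- The gradient `∇φ` of a smooth vector field, with `(i, j)` entry `∂ⱼ φᵢ`. -/
def gradMat (φ : Vec n → Vec n) (x : Vec n) : Mat n := matOf (fderiv ℝ φ x)

/-- The pairs `(φ, ∇φ) ∈ L₂(Ω)ⁿ × L₂(Ω)ⁿˣⁿ` with `φ ∈ C_c^∞(Ω)ⁿ`. -/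
def testPairs (Ω : FlowDomain n) : Submodule ℝ (WithLp 2 (L2 Ω (Vec n) × L2 Ω (Mat n))) where
  carrier := {w | ∃ φ : Vec n → Vec n, ContDiff ℝ ∞ φ ∧ HasCompactSupport φ ∧
    tsupport φ ⊆ Ω.carrier ∧ w.fst =ᵐ[vol Ω] φ ∧ w.snd =ᵐ[vol Ω] gradMat φ}
  zero_mem' := by
    refine ⟨0, contDiff_const, HasCompactSupport.zero, by simp, Lp.coeFn_zero _ _ _, ?_⟩
    filter_upwards [Lp.coeFn_zero (Mat n) 2 (vol Ω)] with x hx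
    rw [WithLp.zero_snd, hx]
    simp [gradMat]
  add_mem' := by
    rintro a b ⟨φ, h1, h2, h3, h4, h5⟩ ⟨ψ, k1, k2, k3, k4, k5⟩
    refine ⟨φ + ψ, h1.add k1, h2.add k2, (tsupport_add φ ψ).trans (Set.union_subset h3 k3), ?_, ?_⟩
    · filter_upwards [h4, k4, Lp.coeFn_add a.fst b.fst] with x h k e
      rw [WithLp.add_fst, e, Pi.add_apply, h, k, Pi.add_apply]
    · filter_upwards [h5, k5, Lp.coeFn_add a.snd b.snd] with x h k e
      rw [WithLp.add_snd, e, Pi.add_apply, h, k, gradMat, gradMat, gradMat, fderiv_add, map_add]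
      · exact (h1.differentiable (by simp)) x
      · exact (k1.differentiable (by simp)) x
  smul_mem' := by
    rintro c a ⟨φ, h1, h2, h3, h4, h5⟩
    refine ⟨c • φ, h1.const_smul c, h2.smul_left (f := fun _ => c),
      (closure_mono (Function.support_const_smul_subset c φ)).trans h3, ?_, ?_⟩
    · filter_upwards [h4, Lp.coeFn_smul c a.fst] with x h e
      rw [WithLp.smul_fst, e, Pi.smul_apply, h, Pi.smul_apply]
    · filter_upwards [h5, Lp.coeFn_smul c a.snd] with x h e
      rw [WithLp.smul_snd, e, Pi.smul_apply, h, gradMat, gradMat, fderiv_const_smul, map_smul]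
      exact (h1.differentiable (by simp)) x

/-- The Sobolev space `H₀¹(Ω)ⁿ`: the closure of `C_c^∞(Ω)ⁿ` in the norm
`(‖u‖²_{L₂} + ‖∇u‖²_{L₂})^{1/2}`, a function being stored together with its weak gradient. -/
abbrev H10 (Ω : FlowDomain n) : Type := (testPairs Ω).topologicalClosure

/-- The function underlying an element of `H₀¹(Ω)ⁿ`. -/
def toL2 (Ω : FlowDomain n) : H10 Ω →L[ℝ] L2 Ω (Vec n) :=
  (WithLp.fstL 2 ℝ (L2 Ω (Vec n)) (L2 Ω (Mat n))).comp (testPairs Ω).topologicalClosure.subtypeL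

/-- The weak gradient `∇u`, with `(i, j)` entry `∂ⱼ uᵢ`. -/
def grad (Ω : FlowDomain n) : H10 Ω →L[ℝ] L2 Ω (Mat n) :=
  (WithLp.sndL 2 ℝ (L2 Ω (Vec n)) (L2 Ω (Mat n))).comp (testPairs Ω).topologicalClosure.subtypeL

theorem exists_norm_le_matOf (n : ℕ) :
    ∃ K : ℝ≥0, ∀ A : Vec n →L[ℝ] Vec n, ‖A‖ ≤ K * ‖matOf A‖ := by
  obtain ⟨K, -, hK⟩ := (matOf (n := n)).exists_antilipschitzWith (by
    rw [LinearMap.ker_eq_bot']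
    intro A hA
    ext v i
    have h : ∀ i j, A (EuclideanSpace.single j 1) i = 0 := fun i j => by
      have := congrArg (fun M : Mat n => M (i, j)) hA
      simpa [matOf] using this
    have hv : v = ∑ j, v j • EuclideanSpace.single j (1 : ℝ) := by
      ext k; simp [Pi.single_apply]
    rw [hv]
    simp [h])
  exact ⟨K, fun A => by simpa [dist_zero_right] using hK.le_mul_dist A 0⟩

theorem sobolev_test (Ω : FlowDomain n) : ∃ C : ℝ≥0,
    ∀ w ∈ testPairs Ω, eLpNorm w.fst 4 (vol Ω) ≤ C * ‖w‖ₑ := by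
  obtain ⟨K, hK⟩ := exists_norm_le_matOf n
  have h2 := Ω.two_le
  have h4 := Ω.le_four
  obtain ⟨p, hp1, hp2, hpn, hpq⟩ : ∃ p : ℝ≥0, 1 ≤ p ∧ p ≤ 2 ∧ p < n ∧
      ((p⁻¹ : ℝ≥0) : ℝ) - (n : ℝ)⁻¹ ≤ (((4 : ℝ≥0)) : ℝ)⁻¹ := by
    rcases (by omega : n = 2 ∨ n = 3 ∨ n = 4) with h | h | h
    · subst h
      refine ⟨4 / 3, ?_, ?_, ?_, ?_⟩
      · rw [← NNReal.coe_le_coe]; push_cast; norm_num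
      · rw [← NNReal.coe_le_coe]; push_cast; norm_num
      · rw [← NNReal.coe_lt_coe]; push_cast; norm_num
      · push_cast; norm_num
    · subst h
      exact ⟨2, by norm_num, le_rfl, by norm_num, by push_cast; norm_num⟩
    · subst h
      exact ⟨2, by norm_num, le_rfl, by norm_num, by push_cast; norm_num⟩
  set C₁ := eLpNormLESNormFDerivOfLeConst (Vec n) (volume : Measure (Vec n)) Ω.carrier p 4
  obtain ⟨M, hM⟩ : ∃ M : ℝ≥0, (vol Ω) Set.univ ^ (1 / (p : ℝ≥0∞).toReal - 1 / (2 : ℝ≥0∞).toReal)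
      = M := by
    have : (vol Ω) Set.univ ^ (1 / (p : ℝ≥0∞).toReal - 1 / (2 : ℝ≥0∞).toReal) ≠ ⊤ := by
      refine ENNReal.rpow_ne_top_of_nonneg ?_ (measure_ne_top _ _)
      simp only [ENNReal.coe_toReal, ENNReal.toReal_ofNat, sub_nonneg]
      have : (0 : ℝ) < p := lt_of_lt_of_le one_pos (by exact_mod_cast hp1)
      exact one_div_le_one_div_of_le this (by exact_mod_cast hp2)
    exact ⟨_, (ENNReal.coe_toNNReal this).symm⟩
  refine ⟨C₁ * K * M, ?_⟩
  rintro w ⟨φ, h1, h2, h3, h4, h5⟩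
  have hsub : Function.support φ ⊆ Ω.carrier := subset_closure.trans h3
  have hsub' : Function.support (fderiv ℝ φ) ⊆ Ω.carrier :=
    (subset_closure.trans (tsupport_fderiv_subset ℝ (f := φ))).trans h3
  have hres : eLpNorm (fderiv ℝ φ) p (vol Ω) = eLpNorm (fderiv ℝ φ) p volume := by
    rw [← eLpNorm_norm, ← eLpNorm_norm (fderiv ℝ φ)]
    refine eLpNorm_restrict_eq_of_support_subset (f := fun x => ‖fderiv ℝ φ x‖) ?_
    intro x hx
    refine hsub' fun h0 => hx ?_
    simp [h0]
  calc eLpNorm w.fst 4 (vol Ω) = eLpNorm φ 4 (vol Ω) := eLpNorm_congr_ae h4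
    _ ≤ eLpNorm φ 4 volume := eLpNorm_mono_measure _ Measure.restrict_le_self
    _ ≤ C₁ * eLpNorm (fderiv ℝ φ) p volume := by
        have := eLpNorm_le_eLpNorm_fderiv_of_le (μ := (volume : Measure (Vec n))) (q := 4)
          (h1.of_le (by simp)) hsub hp1 (by simpa using hpn) (by simpa using hpq) Ω.isBounded
        simpa using! this
    _ = C₁ * eLpNorm (fderiv ℝ φ) p (vol Ω) := by
        rw [hres]
    _ ≤ C₁ * (K * eLpNorm (gradMat φ) p (vol Ω)) := by
        gcongr
        refine eLpNorm_le_nnreal_smul_eLpNorm_of_ae_le_mul (.of_forall fun x => ?_) _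
        exact hK _
    _ ≤ C₁ * (K * (M * ‖w‖ₑ)) := by
        gcongr
        rw [← eLpNorm_congr_ae h5]
        refine (eLpNorm_le_eLpNorm_mul_rpow_measure_univ (q := 2) (by exact_mod_cast hp2)
          (Lp.aestronglyMeasurable _)).trans ?_
        rw [hM, mul_comm, ← Lp.enorm_def]
        gcongr
        rw [← ofReal_norm, ← ofReal_norm]
        exact ENNReal.ofReal_le_ofReal (WithLp.norm_snd_le _ _)
    _ = _ := by push_cast; ring

theorem sobolev (Ω : FlowDomain n) : ∃ C : ℝ≥0,
    ∀ u : H10 Ω, eLpNorm (toL2 Ω u) 4 (vol Ω) ≤ C * ‖u‖ₑ := by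
  obtain ⟨C, hC⟩ := sobolev_test Ω
  refine ⟨C, fun u => ?_⟩
  obtain ⟨w, hw, hlim⟩ := mem_closure_iff_seq_limit.1 u.2
  have hfst : Tendsto (fun k => (w k).fst) atTop (𝓝 (toL2 Ω u)) :=
    ((WithLp.fstL 2 ℝ (L2 Ω (Vec n)) (L2 Ω (Mat n))).continuous.tendsto _).comp hlim
  obtain ⟨ns, hns, hae⟩ := (tendstoInMeasure_of_tendsto_Lp hfst).exists_seq_tendsto_ae
  refine (Lp.eLpNorm_lim_le_liminf_eLpNorm (fun k => Lp.aestronglyMeasurable _) _ hae).trans ?_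
  have hn : Tendsto (fun k => (C : ℝ≥0∞) * ‖w (ns k)‖ₑ) atTop (𝓝 (C * ‖u‖ₑ)) :=
    ENNReal.Tendsto.const_mul ((hlim.enorm).comp hns.tendsto_atTop) (Or.inr ENNReal.coe_ne_top)
  rw [← hn.liminf_eq]
  exact liminf_le_liminf (.of_forall fun k => hC _ (hw (ns k)))

/-- The integrand `(u · ∇)w · v = ∑ᵢ ∑ⱼ uⱼ (∂ⱼ wᵢ) vᵢ`. -/
def convDensity (Ω : FlowDomain n) (u w v : H10 Ω) (x : Vec n) : ℝ :=
  ∑ i, ∑ j, toL2 Ω u x j * grad Ω w x (i, j) * toL2 Ω v x i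

theorem eLpNorm_convDensity_le (Ω : FlowDomain n) : ∃ C : ℝ≥0, ∀ u w v : H10 Ω,
    AEStronglyMeasurable (convDensity Ω u w v) (vol Ω) ∧
    eLpNorm (convDensity Ω u w v) 1 (vol Ω) ≤ C * ‖u‖ₑ * ‖w‖ₑ * ‖v‖ₑ := by
  obtain ⟨C, hC⟩ := sobolev Ω
  have : ENNReal.HolderTriple 4 4 2 := ⟨by
    rw [← ENNReal.toReal_eq_toReal_iff' (by simp) (by simp), ENNReal.toReal_add (by simp) (by simp)]
    simp; norm_num⟩
  have hm : ∀ u w v : H10 Ω, AEStronglyMeasurable (convDensity Ω u w v) (vol Ω) := by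
    intro u w v
    have hu := (Lp.aestronglyMeasurable (toL2 Ω u)).aemeasurable
    have hv := (Lp.aestronglyMeasurable (toL2 Ω v)).aemeasurable
    have hw := (Lp.aestronglyMeasurable (grad Ω w)).aemeasurable
    refine AEMeasurable.aestronglyMeasurable ?_
    unfold convDensity
    fun_prop
  refine ⟨n * n * C * C, fun u w v => ⟨hm u w v, ?_⟩⟩
  have e1 : eLpNorm (fun x => ‖toL2 Ω u x‖ * ‖toL2 Ω v x‖) 2 (vol Ω) ≤
      1 * eLpNorm (toL2 Ω u) 4 (vol Ω) * eLpNorm (toL2 Ω v) 4 (vol Ω) := by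
    have := eLpNorm_le_eLpNorm_mul_eLpNorm'_of_norm (p := 4) (q := 4) (r := 2) (μ := vol Ω)
      (Lp.aestronglyMeasurable (toL2 Ω u)) (Lp.aestronglyMeasurable (toL2 Ω v))
      (fun a b => ‖a‖ * ‖b‖) 1 (.of_forall fun x => by simp)
    simpa using this
  have e2 : eLpNorm (fun x => ‖grad Ω w x‖ * (‖toL2 Ω u x‖ * ‖toL2 Ω v x‖)) 1 (vol Ω) ≤
      1 * eLpNorm (grad Ω w) 2 (vol Ω) *
        eLpNorm (fun x => ‖toL2 Ω u x‖ * ‖toL2 Ω v x‖) 2 (vol Ω) := by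
    have := eLpNorm_le_eLpNorm_mul_eLpNorm'_of_norm (p := 2) (q := 2) (r := 1) (μ := vol Ω)
      (Lp.aestronglyMeasurable (grad Ω w))
      ((Lp.aestronglyMeasurable (toL2 Ω u)).norm.mul (Lp.aestronglyMeasurable (toL2 Ω v)).norm)
      (fun a b => ‖a‖ * b) 1 (.of_forall fun x => by simp)
    simpa using! this
  have e3 : eLpNorm (convDensity Ω u w v) 1 (vol Ω) ≤ ((n * n : ℝ≥0) : ℝ≥0∞) *
      eLpNorm (fun x => ‖grad Ω w x‖ * (‖toL2 Ω u x‖ * ‖toL2 Ω v x‖)) 1 (vol Ω) := by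
    refine eLpNorm_le_nnreal_smul_eLpNorm_of_ae_le_mul (.of_forall fun x => ?_) _
    rw [← NNReal.coe_le_coe, NNReal.coe_mul, coe_nnnorm, coe_nnnorm,
      Real.norm_of_nonneg (by positivity : 0 ≤ ‖grad Ω w x‖ * (‖toL2 Ω u x‖ * ‖toL2 Ω v x‖))]
    calc ‖convDensity Ω u w v x‖
        ≤ ∑ i : Fin n, ∑ j : Fin n, ‖grad Ω w x‖ * (‖toL2 Ω u x‖ * ‖toL2 Ω v x‖) := by
          refine norm_sum_le_of_le _ fun i _ => norm_sum_le_of_le _ fun j _ => ?_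
          rw [norm_mul, norm_mul]
          calc _ ≤ ‖toL2 Ω u x‖ * ‖grad Ω w x‖ * ‖toL2 Ω v x‖ := by
                gcongr <;> exact PiLp.norm_apply_le _ _
            _ = _ := by ring
      _ = _ := by simp; ring
  have e4 : eLpNorm (grad Ω w) 2 (vol Ω) ≤ ‖w‖ₑ := by
    rw [← Lp.enorm_def, ← ofReal_norm, ← ofReal_norm]
    exact ENNReal.ofReal_le_ofReal (WithLp.norm_snd_le _ _)
  calc _ ≤ ((n * n : ℝ≥0) : ℝ≥0∞) *
        (1 * ‖w‖ₑ * (1 * (C * ‖u‖ₑ) * (C * ‖v‖ₑ))) := by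
        refine e3.trans ?_
        gcongr
        refine e2.trans ?_
        gcongr
        refine e1.trans ?_
        gcongr
        · exact hC u
        · exact hC v
    _ = _ := by push_cast; ring

theorem integrable_convDensity (Ω : FlowDomain n) (u w v : H10 Ω) :
    Integrable (convDensity Ω u w v) (vol Ω) := by
  obtain ⟨C, hC⟩ := eLpNorm_convDensity_le Ω
  refine memLp_one_iff_integrable.1 ⟨(hC u w v).1, (hC u w v).2.trans_lt ?_⟩
  simp [ENNReal.mul_lt_top_iff, enorm_lt_top]

theorem convDensity_bound (Ω : FlowDomain n) : ∃ C : ℝ, ∀ u w v : H10 Ω,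
    ‖∫ x in Ω.carrier, convDensity Ω u w v x‖ ≤ C * ‖u‖ * ‖w‖ * ‖v‖ := by
  obtain ⟨C, hC⟩ := eLpNorm_convDensity_le Ω
  refine ⟨C, fun u w v => ?_⟩
  have h := (enorm_integral_le_lintegral_enorm (μ := vol Ω) (convDensity Ω u w v)).trans
    (eLpNorm_one_eq_lintegral_enorm.symm.le.trans (hC u w v).2)
  have h' := ENNReal.toReal_mono (by finiteness) h
  simpa using h'

/-- The functional `v ↦ ∫_Ω (u · ∇)w · v dx` on `H₀¹(Ω)ⁿ`. -/
def convection (Ω : FlowDomain n) (u w : H10 Ω) : StrongDual ℝ (H10 Ω) :=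
  LinearMap.mkContinuousOfExistsBound
    { toFun := fun v => ∫ x in Ω.carrier, convDensity Ω u w v x
      map_add' := fun v v' => by
        rw [← integral_add (integrable_convDensity Ω u w v) (integrable_convDensity Ω u w v')]
        refine integral_congr_ae ?_
        filter_upwards [Lp.coeFn_add (toL2 Ω v) (toL2 Ω v')] with x hx
        simp only [convDensity, map_add, hx, Pi.add_apply, PiLp.add_apply, mul_add,
          Finset.sum_add_distrib]
      map_smul' := fun c v => by
        rw [RingHom.id_apply, smul_eq_mul, ← integral_const_mul]
        refine integral_congr_ae ?_
        filter_upwards [Lp.coeFn_smul c (toL2 Ω v)] with x hx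
        simp only [convDensity, map_smul, hx, Pi.smul_apply, PiLp.smul_apply, Finset.mul_sum,
          smul_eq_mul]
        exact Finset.sum_congr rfl fun i _ => Finset.sum_congr rfl fun j _ => by ring }
    (by
      obtain ⟨C, hC⟩ := convDensity_bound Ω
      exact ⟨C * ‖u‖ * ‖w‖, hC u w⟩)

/-- The divergence `div u = ∑ᵢ ∂ᵢ uᵢ`. -/
def divergence (Ω : FlowDomain n) : H10 Ω →L[ℝ] L2 Ω ℝ :=
  (ContinuousLinearMap.compLpL 2 (vol Ω)
    (∑ i : Fin n, EuclideanSpace.proj (𝕜 := ℝ) (i, i) : Mat n →L[ℝ] ℝ)).comp (grad Ω)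

/-- The curl as a function of the gradient matrix: `∂₁u₂ - ∂₂u₁` for `n = 2`, and
`(∂₂u₃ - ∂₃u₂, ∂₃u₁ - ∂₁u₃, ∂₁u₂ - ∂₂u₁)` for `n = 3` (a dummy value for other `n`). -/
def curlMat : (n : ℕ) → (Mat n →ₗ[ℝ] Vec (2 * n - 3))
  | 2 =>
    { toFun := fun A => !₂[A (1, 0) - A (0, 1)]
      map_add' := fun A B => by ext i; fin_cases i; simp; ring
      map_smul' := fun c A => by ext i; fin_cases i; simp; ring }
  | 3 =>
    { toFun := fun A => !₂[A (2, 1) - A (1, 2), A (0, 2) - A (2, 0), A (1, 0) - A (0, 1)]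
      map_add' := fun A B => by ext i; fin_cases i <;> simp <;> ring
      map_smul' := fun c A => by ext i; fin_cases i <;> simp <;> ring }
  | _ => 0

/-- The curl of a velocity field, in `L₂(Ω)^{2n-3}`. -/
def curl (Ω : FlowDomain n) : H10 Ω →L[ℝ] L2 Ω (Vec (2 * n - 3)) :=
  (ContinuousLinearMap.compLpL 2 (vol Ω) (curlMat n).toContinuousLinearMap).comp (grad Ω)

/-- `L₂(Ω)/ℝ`, realized isometrically as the space of functions of mean zero in `L₂(Ω)`,
i.e. as the orthogonal complement of the constants. -/
abbrev L2modR (Ω : FlowDomain n) : Type := (ℝ ∙ (Lp.const 2 (vol Ω) (1 : ℝ)))ᗮ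

theorem mem_L2modR_iff (Ω : FlowDomain n) (p : L2 Ω ℝ) :
    p ∈ (ℝ ∙ (Lp.const 2 (vol Ω) (1 : ℝ)))ᗮ ↔ ∫ x in Ω.carrier, p x = 0 := by
  rw [Submodule.mem_orthogonal_singleton_iff_inner_right, L2.inner_def]
  have : (fun x => inner ℝ (Lp.const 2 (vol Ω) (1 : ℝ) x) (p x)) =ᵐ[vol Ω] p := by
    filter_upwards [Lp.coeFn_const (p := 2) (μ := vol Ω) (1 : ℝ)] with x hx
    rw [hx]; simp
  rw [integral_congr_ae this]

/-- The space `𝒰 = H₀¹(Ω)ⁿ × L₂(Ω)/ℝ` of pairs (velocity, pressure). -/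
abbrev VelPres (Ω : FlowDomain n) : Type := WithLp 2 (H10 Ω × L2modR Ω)

/-- The velocity component `𝒰 → H₀¹(Ω)ⁿ`. -/
abbrev velL (Ω : FlowDomain n) : VelPres Ω →L[ℝ] H10 Ω := WithLp.fstL 2 ℝ (H10 Ω) (L2modR Ω)

/-- The pressure component `𝒰 → L₂(Ω)/ℝ ⊆ L₂(Ω)`. -/
abbrev presL (Ω : FlowDomain n) : VelPres Ω →L[ℝ] L2 Ω ℝ :=
  (Submodule.subtypeL _).comp (WithLp.sndL 2 ℝ (H10 Ω) (L2modR Ω))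

/-- The stationary Navier-Stokes operator `G : 𝒰 → 𝒰'`,
`G(u,p)(v,q) = ∫ ∇u : ∇v - p div v + ν^{-3/2} (u·∇)u·v + q (div u - g) dx - f(v)`. -/
def navierStokes (Ω : FlowDomain n) (ν : ℝ) (f : StrongDual ℝ (H10 Ω)) (g : L2modR Ω)
    (z : VelPres Ω) : StrongDual ℝ (VelPres Ω) :=
  ((innerSL ℝ (grad Ω z.fst)).comp (grad Ω) - (innerSL ℝ (z.snd : L2 Ω ℝ)).comp (divergence Ω)
    + ν ^ (-(3 / 2) : ℝ) • convection Ω z.fst z.fst - f).comp (velL Ω)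
  + (innerSL ℝ (divergence Ω z.fst - (g : L2 Ω ℝ))).comp (presL Ω)

/-- The integral formula for `G`. -/
theorem navierStokes_apply (Ω : FlowDomain n) (ν : ℝ) (f : StrongDual ℝ (H10 Ω)) (g : L2modR Ω)
    (z w : VelPres Ω) :
    navierStokes Ω ν f g z w =
      (∫ x in Ω.carrier, inner ℝ (grad Ω z.fst x) (grad Ω w.fst x))
      - (∫ x in Ω.carrier, (z.snd : L2 Ω ℝ) x * divergence Ω w.fst x)
      + ν ^ (-(3 / 2) : ℝ) * (∫ x in Ω.carrier, convDensity Ω z.fst z.fst w.fst x)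
      + (∫ x in Ω.carrier, (w.snd : L2 Ω ℝ) x * (divergence Ω z.fst x - (g : L2 Ω ℝ) x))
      - f w.fst := by
  have h : (∫ x in Ω.carrier, (w.snd : L2 Ω ℝ) x * (divergence Ω z.fst x - (g : L2 Ω ℝ) x)) =
      inner ℝ (divergence Ω z.fst - (g : L2 Ω ℝ)) (w.snd : L2 Ω ℝ) := by
    rw [L2.inner_def]
    refine integral_congr_ae ?_
    filter_upwards [Lp.coeFn_sub (divergence Ω z.fst) (g : L2 Ω ℝ)] with x hx
    simp only [RCLike.inner_apply, conj_trivial]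
    rw [hx]; rfl
  rw [h]
  have h1 : navierStokes Ω ν f g z w = inner ℝ (grad Ω z.fst) (grad Ω w.fst)
      - inner ℝ (z.snd : L2 Ω ℝ) (divergence Ω w.fst)
      + ν ^ (-(3 / 2) : ℝ) * convection Ω z.fst z.fst w.fst - f w.fst
      + inner ℝ (divergence Ω z.fst - (g : L2 Ω ℝ)) (w.snd : L2 Ω ℝ) := rfl
  rw [h1, L2.inner_def, L2.inner_def]
  have h2 : convection Ω z.fst z.fst w.fst =
    ∫ x in Ω.carrier, convDensity Ω z.fst z.fst w.fst x := rfl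
  rw [h2]
  have h3 : (∫ x in Ω.carrier, inner ℝ ((z.snd : L2 Ω ℝ) x) (divergence Ω w.fst x)) =
      ∫ x in Ω.carrier, (z.snd : L2 Ω ℝ) x * divergence Ω w.fst x :=
    integral_congr_ae (.of_forall fun x => by
      simp only [RCLike.inner_apply, conj_trivial]; exact mul_comm _ _)
  rw [h3]
  ring

/-- The product space `𝒰 × 𝒯` with `𝒯 = L₂(Ω; F)`. -/
abbrev Trial (Ω : FlowDomain n) (F : Type) [NormedAddCommGroup F] [InnerProductSpace ℝ F] : Type :=
  WithLp 2 (VelPres Ω × L2 Ω F)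

/-- The product space `𝒰' × 𝒯` with `𝒯 = L₂(Ω; F)`. -/
abbrev Resid (Ω : FlowDomain n) (F : Type) [NormedAddCommGroup F] [InnerProductSpace ℝ F] : Type :=
  WithLp 2 (StrongDual ℝ (VelPres Ω) × L2 Ω F)

/-- The functional
`v ↦ ∫ θ : ∇v - p div v + ν^{-3/2} (u·∇)u·v dx - f(v)` in `H⁻¹(Ω)ⁿ`. -/
def momentumGrad (Ω : FlowDomain n) (ν : ℝ) (f : StrongDual ℝ (H10 Ω)) (y : Trial Ω (Mat n)) :
    StrongDual ℝ (H10 Ω) :=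
  (innerSL ℝ y.snd).comp (grad Ω) - (innerSL ℝ (y.fst.snd : L2 Ω ℝ)).comp (divergence Ω)
    + ν ^ (-(3 / 2) : ℝ) • convection Ω y.fst.fst y.fst.fst - f

/-- The velocity-pressure-velocity gradient system `H(u,p,θ)`. -/
def sysGrad (Ω : FlowDomain n) (ν : ℝ) (f : StrongDual ℝ (H10 Ω)) (g : L2modR Ω)
    (y : Trial Ω (Mat n)) : Resid Ω (Mat n) :=
  WithLp.toLp 2
    ((momentumGrad Ω ν f y).comp (velL Ω)
      + (innerSL ℝ (divergence Ω y.fst.fst - (g : L2 Ω ℝ))).comp (presL Ω),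
    y.snd - grad Ω y.fst.fst)

/-- The least squares functional `Q(u,p,θ)` of the velocity-pressure-velocity gradient system. -/
def lsGrad (Ω : FlowDomain n) (ν : ℝ) (f : StrongDual ℝ (H10 Ω)) (g : L2modR Ω)
    (y : Trial Ω (Mat n)) : ℝ :=
  1 / 2 * (‖momentumGrad Ω ν f y‖ ^ 2 + ‖divergence Ω y.fst.fst - (g : L2 Ω ℝ)‖ ^ 2
    + ‖y.snd - grad Ω y.fst.fst‖ ^ 2)

/-- The functional
`v ↦ ∫ ω · curl v - p div v + ν^{-3/2} (u·∇)u·v dx - f(v)` in `H⁻¹(Ω)ⁿ`. -/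
def momentumVort (Ω : FlowDomain n) (ν : ℝ) (f : StrongDual ℝ (H10 Ω))
    (y : Trial Ω (Vec (2 * n - 3))) : StrongDual ℝ (H10 Ω) :=
  (innerSL ℝ y.snd).comp (curl Ω) - (innerSL ℝ (y.fst.snd : L2 Ω ℝ)).comp (divergence Ω)
    + ν ^ (-(3 / 2) : ℝ) • convection Ω y.fst.fst y.fst.fst - f

/-- The functional `v ↦ ∫ div u div v dx` in `H⁻¹(Ω)ⁿ`. -/
def divDiv (Ω : FlowDomain n) (u : H10 Ω) : StrongDual ℝ (H10 Ω) :=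
  (innerSL ℝ (divergence Ω u)).comp (divergence Ω)

/-- The system `H₁(u,p,ω)`, which contains the second order term `∇ div u`. -/
def sysVort₁ (Ω : FlowDomain n) (ν : ℝ) (f : StrongDual ℝ (H10 Ω)) (g : L2modR Ω)
    (y : Trial Ω (Vec (2 * n - 3))) : Resid Ω (Vec (2 * n - 3)) :=
  WithLp.toLp 2
    ((momentumVort Ω ν f y + divDiv Ω y.fst.fst).comp (velL Ω)
      + (innerSL ℝ (divergence Ω y.fst.fst - (g : L2 Ω ℝ))).comp (presL Ω),
    y.snd - curl Ω y.fst.fst)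

/-- The least squares functional `Q₁(u,p,ω)`. -/
def lsVort₁ (Ω : FlowDomain n) (ν : ℝ) (f : StrongDual ℝ (H10 Ω)) (g : L2modR Ω)
    (y : Trial Ω (Vec (2 * n - 3))) : ℝ :=
  1 / 2 * (‖momentumVort Ω ν f y + divDiv Ω y.fst.fst‖ ^ 2
    + ‖divergence Ω y.fst.fst - (g : L2 Ω ℝ)‖ ^ 2 + ‖y.snd - curl Ω y.fst.fst‖ ^ 2)

/-- The velocity-pressure-vorticity system `H₂(u,p,ω)` (for `g = 0`). -/
def sysVort₂ (Ω : FlowDomain n) (ν : ℝ) (f : StrongDual ℝ (H10 Ω))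
    (y : Trial Ω (Vec (2 * n - 3))) : Resid Ω (Vec (2 * n - 3)) :=
  WithLp.toLp 2
    ((momentumVort Ω ν f y).comp (velL Ω)
      + (innerSL ℝ (divergence Ω y.fst.fst)).comp (presL Ω),
    y.snd - curl Ω y.fst.fst)

/-- The least squares functional `Q₂(u,p,ω)`. -/
def lsVort₂ (Ω : FlowDomain n) (ν : ℝ) (f : StrongDual ℝ (H10 Ω))
    (y : Trial Ω (Vec (2 * n - 3))) : ℝ :=
  1 / 2 * (‖momentumVort Ω ν f y‖ ^ 2 + ‖divergence Ω y.fst.fst‖ ^ 2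
    + ‖y.snd - curl Ω y.fst.fst‖ ^ 2)

/-- `A` is a homeomorphism onto its range: `‖A v‖ ≂ ‖v‖`. -/
def IsHomeoOntoRange {X Y : Type*} [NormedAddCommGroup X] [NormedSpace ℝ X]
    [NormedAddCommGroup Y] [NormedSpace ℝ Y] (A : X →L[ℝ] Y) : Prop :=
  ∃ r R : ℝ, 0 < r ∧ 0 < R ∧ ∀ v, r * ‖v‖ ≤ ‖A v‖ ∧ ‖A v‖ ≤ R * ‖v‖

/-- `H = 0` is well posed at its solution `x`: `x` is a root, `H` is twice continuously
differentiable near `x`, and `DH(x)` is a homeomorphism onto its range. -/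
structure WellPosedAt {X Y : Type*} [NormedAddCommGroup X] [NormedSpace ℝ X]
    [NormedAddCommGroup Y] [NormedSpace ℝ Y] (H : X → Y) (x : X) : Prop where
  root : H x = 0
  contDiff : ContDiffAt ℝ 2 H x
  homeo : IsHomeoOntoRange (fderiv ℝ H x)

/-- The normal equations `DQ = 0` are well posed at `x`: `Q` is differentiable near `x`, `x` solves
`DQ = 0`, `DQ` is continuously differentiable near `x`, and `D²Q(x)` is symmetric, coercive and
boundedly invertible. Moreover `x` is the only solution of `DQ = 0` near `x`. -/
structure NormalEqWellPosedAt {X : Type*} [NormedAddCommGroup X] [NormedSpace ℝ X]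
    (Q : X → ℝ) (x : X) : Prop where
  differentiable : ∀ᶠ y in 𝓝 x, DifferentiableAt ℝ Q y
  root : fderiv ℝ Q x = 0
  contDiff : ContDiffAt ℝ 1 (fderiv ℝ Q) x
  symm : ∀ h k, fderiv ℝ (fderiv ℝ Q) x h k = fderiv ℝ (fderiv ℝ Q) x k h
  coercive : IsCoercive (fderiv ℝ (fderiv ℝ Q) x)
  invertible : ∃ e : X ≃L[ℝ] StrongDual ℝ X,
    (e : X →L[ℝ] StrongDual ℝ X) = fderiv ℝ (fderiv ℝ Q) x
  isolated : ∀ᶠ y in 𝓝 x, fderiv ℝ Q y = 0 → y = x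

/-- `Q(y) ≂ ‖y - x‖²` for `y` in a neighbourhood of `x`. -/
def EquivSqDistNear {X : Type*} [NormedAddCommGroup X] (Q : X → ℝ) (x : X) : Prop :=
  ∃ c C : ℝ, 0 < c ∧ 0 < C ∧ ∀ᶠ y in 𝓝 x, c * ‖y - x‖ ^ 2 ≤ Q y ∧ Q y ≤ C * ‖y - x‖ ^ 2

end
end NavierStokes

open NavierStokes

/-!
Each of the three first order systems is, up to a bounded invertible linear change of the residual,
the pair `(G(u,p), θ - K(u,p))`, where `G` is the Navier-Stokes operator and `K` is the gradient or
the curl of the velocity. With `E` the adjoint of `K`, the residual is `(P G + E (θ - K), θ - K)`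
for an automorphism `P` of `𝒰'` (`augmented`). Hence its zeros are the zeros of `G` together with
`θ = K(u,p)`, and its derivative is bounded below wherever that of `G` is
(`WellPosedAt.augmented`).

* For the velocity gradient, `P` is the identity.
* For the vorticity, the identity `∫ ∇u : ∇v = ∫ curl u · curl v + ∫ div u div v` on `H₀¹`
  (`inner_grad_eq`) enters. It follows by density from test functions, for which it amounts to
  `∫ ∂ⱼφᵢ ∂ᵢψⱼ = ∫ ∂ᵢφᵢ ∂ⱼψⱼ`. With the term `∇ div u` present, `P` is again the identity.
* Without that term and with `g = 0`, `P` subtracts `v ↦ ∫ div u div v`. This is a linear function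
  of `G(u,p)`, because `div u` represents the pressure part of `G(u,p)`; as the pressure part of
  what is subtracted vanishes, `P = 1 - S` with `S² = 0` (`subPresToDiv`).

The functionals are `½‖H‖²` because the dual norm splits into its velocity and pressure parts, the
latter being the `L₂` norm of its representative `div u - g`; that `div u` has mean zero
(`divergence_mem_L2modR`) matters here. The operator `G` is a continuous polynomial of degree two,
hence smooth. The remaining claims hold for `½‖H‖²` whenever `H` is well posed at `x` and takes
values in a Hilbert space: the Hessian at `x` is `⟪DH(x) ·, DH(x) ·⟫`, which is coercive, and the
inverse function theorem isolates the critical point (`WellPosedAt.normalEq`).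
-/

namespace NavierStokes

noncomputable section

/-! ### Least squares for a well-posed equation in Hilbert space -/

theorem IsHomeoOntoRange.of_le {X Y : Type*} [NormedAddCommGroup X] [NormedSpace ℝ X]
    [NormedAddCommGroup Y] [NormedSpace ℝ Y] {A : X →L[ℝ] Y} {C : ℝ}
    (h : ∀ v, ‖v‖ ≤ C * ‖A v‖) : IsHomeoOntoRange A := by
  refine ⟨(|C| + 1)⁻¹, ‖A‖ + 1, by positivity, by positivity, fun v => ⟨?_, ?_⟩⟩
  · rw [inv_mul_le_iff₀ (by positivity)]
    refine (h v).trans ?_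
    gcongr
    linarith [le_abs_self C]
  · exact (A.le_opNorm v).trans (by gcongr; linarith)

/-- The map `y ↦ ⟪y, ·⟫` as a bounded real-linear map; `innerSL ℝ` itself is only semilinear
with respect to the (trivial) conjugation of `ℝ`. -/
def innerDual (E : Type*) [NormedAddCommGroup E] [InnerProductSpace ℝ E] :
    E →L[ℝ] StrongDual ℝ E :=
  ⟨⟨⟨fun y => innerSL ℝ y, map_add _⟩, fun c y => by ext; simp⟩,
    (innerSL ℝ : E →L⋆[ℝ] _).continuous⟩

@[simp] theorem innerDual_apply {E : Type*} [NormedAddCommGroup E] [InnerProductSpace ℝ E]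
    (y : E) : innerDual E y = innerSL ℝ y := rfl

/-- The Riesz isomorphism from a real Hilbert space's dual to the space, as a real-linear
isometry. -/
def riesz (E : Type*) [NormedAddCommGroup E] [InnerProductSpace ℝ E] [CompleteSpace E] :
    StrongDual ℝ E ≃ₗᵢ[ℝ] E where
  toFun := (toDual ℝ E).symm
  invFun := toDual ℝ E
  left_inv := (toDual ℝ E).apply_symm_apply
  right_inv := (toDual ℝ E).symm_apply_apply
  map_add' := map_add _
  map_smul' c y := by simp
  norm_map' := (toDual ℝ E).symm.norm_map

theorem innerSL_riesz {E : Type*} [NormedAddCommGroup E] [InnerProductSpace ℝ E]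
    [CompleteSpace E] (a : StrongDual ℝ E) : innerSL ℝ (riesz E a) = a :=
  (toDual ℝ E).apply_symm_apply a

theorem WellPosedAt.equivSqDistNear {X Y : Type*} [NormedAddCommGroup X] [NormedSpace ℝ X]
    [NormedAddCommGroup Y] [NormedSpace ℝ Y] {H : X → Y} {x : X} (h : WellPosedAt H x) :
    EquivSqDistNear (fun y => 1 / 2 * ‖H y‖ ^ 2) x := by
  obtain ⟨r, R, hr, hR, hA⟩ := h.homeo
  have hd := (h.contDiff.differentiableAt (by norm_num)).hasFDerivAt
  refine ⟨1 / 2 * (r / 2) ^ 2, 1 / 2 * (R + r / 2) ^ 2, by positivity, by positivity, ?_⟩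
  filter_upwards [hd.isLittleO.def (half_pos hr)] with y hy
  rw [h.root, sub_zero] at hy
  obtain ⟨h1, h2⟩ := hA (y - x)
  have h3 := norm_sub_norm_le (H y) (fderiv ℝ H x (y - x))
  have h4 := norm_sub_norm_le (fderiv ℝ H x (y - x)) (H y)
  rw [norm_sub_rev] at h4
  constructor
  · rw [mul_assoc, ← mul_pow]
    gcongr
    linarith
  · rw [mul_assoc, ← mul_pow]
    gcongr
    linarith

/-- Since `H x = 0`, the second derivative of `Q = ½‖H‖²` at `x` is `(h, k) ↦ ⟪DH(x) h, DH(x) k⟫`,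
which is coercive because `DH(x)` is bounded below. Lax-Milgram gives its invertibility, and the
inverse function theorem for `DQ` gives the isolation of `x`. -/
theorem WellPosedAt.normalEq {X Y : Type*} [NormedAddCommGroup X] [InnerProductSpace ℝ X]
    [CompleteSpace X] [NormedAddCommGroup Y] [InnerProductSpace ℝ Y] {H : X → Y} {x : X}
    (h : WellPosedAt H x) : NormalEqWellPosedAt (fun y => 1 / 2 * ‖H y‖ ^ 2) x := by
  set Q : X → ℝ := fun y => 1 / 2 * ‖H y‖ ^ 2
  have hQ : ∀ᶠ y in 𝓝 x, HasFDerivAt Q ((innerDual Y (H y)).comp (fderiv ℝ H y)) y := by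
    filter_upwards [h.contDiff.eventually (by simp)] with y hy
    have := ((hy.differentiableAt (by norm_num)).hasFDerivAt.norm_sq).const_mul (1 / 2)
    refine this.congr_fderiv ?_
    ext k
    simp
  have hDQ : fderiv ℝ Q =ᶠ[𝓝 x] fun y => (innerDual Y (H y)).comp (fderiv ℝ H y) :=
    hQ.mono fun y hy => hy.fderiv
  have hC : ContDiffAt ℝ 1 (fderiv ℝ Q) x := by
    have : ContDiffAt ℝ 2 Q x := contDiffAt_const.mul (h.contDiff.norm_sq ℝ)
    exact this.fderiv_right (by norm_num)
  have hD2 : ∀ u v, fderiv ℝ (fderiv ℝ Q) x u v =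
      inner ℝ (fderiv ℝ H x u) (fderiv ℝ H x v) := by
    intro u v
    have h1 : HasFDerivAt (fun y => innerDual Y (H y)) ((innerDual Y).comp (fderiv ℝ H x)) x :=
      (innerDual Y).hasFDerivAt.comp x
        (h.contDiff.differentiableAt (by norm_num)).hasFDerivAt
    have h2 : HasFDerivAt (fderiv ℝ H) (fderiv ℝ (fderiv ℝ H) x) x :=
      ((h.contDiff.fderiv_right (m := 1) (by norm_num)).differentiableAt
        (by norm_num)).hasFDerivAt
    rw [hDQ.fderiv_eq, (h1.clm_comp h2).fderiv]
    simp [h.root]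
  obtain ⟨r, R, hr, hR, hA⟩ := h.homeo
  have hcoer : IsCoercive (fderiv ℝ (fderiv ℝ Q) x) := by
    refine ⟨r ^ 2, by positivity, fun u => ?_⟩
    rw [hD2, real_inner_self_eq_norm_sq]
    calc r ^ 2 * ‖u‖ * ‖u‖ = (r * ‖u‖) ^ 2 := by ring
      _ ≤ _ := by gcongr; exact (hA u).1
  have hinv : ∃ e : X ≃L[ℝ] StrongDual ℝ X,
      (e : X →L[ℝ] StrongDual ℝ X) = fderiv ℝ (fderiv ℝ Q) x := by
    refine ⟨hcoer.continuousLinearEquivOfBilin.trans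
      (riesz X).symm.toContinuousLinearEquiv, ?_⟩
    ext u v
    exact hcoer.continuousLinearEquivOfBilin_apply u v
  refine ⟨hQ.mono fun y hy => hy.differentiableAt, ?_, hC,
    fun u v => by rw [hD2, hD2, real_inner_comm], hcoer, hinv, ?_⟩
  · rw [hDQ.eq_of_nhds, h.root]
    simp
  · obtain ⟨e, he⟩ := hinv
    have hs : HasStrictFDerivAt (fderiv ℝ Q) (e : X →L[ℝ] StrongDual ℝ X) x := by
      rw [he]
      exact hC.hasStrictFDerivAt (by norm_num)
    have h0 : fderiv ℝ Q x = 0 := by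
      rw [hDQ.eq_of_nhds, h.root]
      simp
    filter_upwards [hs.eventually_left_inverse] with y hy hy0
    rw [← hy, hy0, ← h0, hs.eventually_left_inverse.self_of_nhds]

theorem WellPosedAt.isometry_comp {X Y Z : Type*} [NormedAddCommGroup X] [NormedSpace ℝ X]
    [NormedAddCommGroup Y] [NormedSpace ℝ Y] [NormedAddCommGroup Z] [NormedSpace ℝ Z]
    {H : X → Y} {x : X} (h : WellPosedAt H x) (Φ : Y →ₗᵢ[ℝ] Z) :
    WellPosedAt (fun y => Φ (H y)) x := by
  refine ⟨by simp [h.root], Φ.toContinuousLinearMap.contDiff.contDiffAt.comp x h.contDiff, ?_⟩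
  have := (Φ.toContinuousLinearMap.hasFDerivAt.comp x
    (h.contDiff.differentiableAt (by norm_num)).hasFDerivAt).fderiv
  obtain ⟨r, R, hr, hR, hA⟩ := h.homeo
  refine ⟨r, R, hr, hR, fun v => ?_⟩
  have e : fderiv ℝ (fun y => Φ (H y)) x v = Φ (fderiv ℝ H x v) := congrArg (· v) this
  rw [e, Φ.norm_map]
  exact hA v

/-- The case in which the residual space is the product of a dual space and a Hilbert space. -/
theorem WellPosedAt.normalEq_dual {X V F : Type*} [NormedAddCommGroup X] [InnerProductSpace ℝ X]
    [CompleteSpace X] [NormedAddCommGroup V] [InnerProductSpace ℝ V] [CompleteSpace V]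
    [NormedAddCommGroup F] [InnerProductSpace ℝ F]
    {H : X → WithLp 2 (StrongDual ℝ V × F)} {x : X} (h : WellPosedAt H x) :
    NormalEqWellPosedAt (fun y => 1 / 2 * ‖H y‖ ^ 2) x := by
  let Φ : WithLp 2 (StrongDual ℝ V × F) →ₗᵢ[ℝ] WithLp 2 (V × F) :=
    (riesz V).toLinearIsometry.withLpProdMap 2 LinearIsometry.id
  have := (h.isometry_comp Φ).normalEq
  simpa only [Φ.norm_map] using this

/-! ### First order systems equivalent to a given equation -/

section System

variable {X Y F : Type*} [NormedAddCommGroup X] [NormedSpace ℝ X]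
  [NormedAddCommGroup Y] [NormedSpace ℝ Y] [NormedAddCommGroup F] [NormedSpace ℝ F]

/-- The system for `(z, θ)` obtained from the equation `G z = 0` by introducing the variable
`θ = K z`: its residual is the image of `(G z, θ - K z)` under the bounded invertible linear map
`(a, b) ↦ (P a + E b, b)`. -/
def augmented (G : X → Y) (K : X →L[ℝ] F) (P : Y ≃L[ℝ] Y) (E : F →L[ℝ] Y)
    (y : WithLp 2 (X × F)) : WithLp 2 (Y × F) :=
  WithLp.toLp 2 (P (G y.fst) + E (y.snd - K y.fst), y.snd - K y.fst)

variable {G : X → Y} {K : X →L[ℝ] F} {P : Y ≃L[ℝ] Y} {E : F →L[ℝ] Y}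

theorem augmented_eq_zero {y : WithLp 2 (X × F)} :
    augmented G K P E y = 0 ↔ G y.fst = 0 ∧ y.snd = K y.fst := by
  constructor
  · intro h
    have h1 : P (G y.fst) + E (y.snd - K y.fst) = 0 := congrArg WithLp.fst h
    have h2 : y.snd - K y.fst = 0 := congrArg WithLp.snd h
    rw [h2, map_zero, add_zero] at h1
    exact ⟨by simpa using h1, sub_eq_zero.1 h2⟩
  · rintro ⟨h1, h2⟩
    simp [augmented, h1, h2]

theorem WellPosedAt.augmented {z : X} (h : WellPosedAt G z) :
    WellPosedAt (augmented G K P E) (WithLp.toLp 2 (z, K z)) := by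
  set x : WithLp 2 (X × F) := WithLp.toLp 2 (z, K z)
  set fstX : WithLp 2 (X × F) →L[ℝ] X := WithLp.fstL 2 ℝ X F
  set D : WithLp 2 (X × F) →L[ℝ] F := WithLp.sndL 2 ℝ X F - K.comp fstX
  set T := (WithLp.prodContinuousLinearEquiv 2 ℝ Y F).symm
  have hH : NavierStokes.augmented G K P E = fun y => T (P (G (fstX y)) + E (D y), D y) := rfl
  have hG : HasFDerivAt G (fderiv ℝ G z) (fstX x) :=
    (h.contDiff.differentiableAt (by norm_num)).hasFDerivAt
  have hd : HasFDerivAt (NavierStokes.augmented G K P E)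
      ((T : Y × F →L[ℝ] WithLp 2 (Y × F)).comp
        ((((P : Y →L[ℝ] Y).comp ((fderiv ℝ G z).comp fstX)) + E.comp D).prod D)) x := by
    rw [hH]
    exact T.hasFDerivAt.comp x
      (((P.hasFDerivAt.comp x (hG.comp x fstX.hasFDerivAt)).add (E.comp D).hasFDerivAt).prodMk
        D.hasFDerivAt)
  refine ⟨augmented_eq_zero.2 ⟨h.root, rfl⟩, ?_, ?_⟩
  · rw [hH]
    refine T.contDiff.contDiffAt.comp x ?_
    have hc : ContDiffAt ℝ 2 G (fstX x) := h.contDiff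
    exact ((P.contDiff.contDiffAt.comp x (hc.comp x fstX.contDiff.contDiffAt)).add
      (E.comp D).contDiff.contDiffAt).prodMk D.contDiff.contDiffAt
  · rw [hd.fderiv]
    obtain ⟨r, R, hr, hR, hA⟩ := h.homeo
    set Pi : Y →L[ℝ] Y := (P.symm : Y →L[ℝ] Y)
    set c := r⁻¹ * (‖Pi‖ * (1 + ‖E‖))
    have hc : 0 ≤ c := by positivity
    -- `c` bounds `w.fst` in terms of `DH w`, by undoing `E`, then `P`, then `DG`; the second
    -- component is `w.snd = D w + K w.fst`.
    refine .of_le (C := c + (1 + ‖K‖ * c)) fun w => ?_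
    set a : Y := P (fderiv ℝ G z w.fst) + E (D w)
    set Aw : WithLp 2 (Y × F) := WithLp.toLp 2 (a, D w)
    change ‖w‖ ≤ (c + (1 + ‖K‖ * c)) * ‖Aw‖
    have ha : ‖a‖ ≤ ‖Aw‖ := WithLp.norm_fst_le _ Aw
    have hb : ‖D w‖ ≤ ‖Aw‖ := WithLp.norm_snd_le _ Aw
    have h1 : ‖fderiv ℝ G z w.fst‖ ≤ ‖Pi‖ * (‖Aw‖ + ‖E‖ * ‖Aw‖) := by
      have e : fderiv ℝ G z w.fst = Pi (a - E (D w)) := by simp [a, Pi]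
      rw [e]
      refine (Pi.le_opNorm _).trans ?_
      gcongr
      refine (norm_sub_le _ _).trans (add_le_add ha ((E.le_opNorm _).trans ?_))
      gcongr
    have h2 : ‖w.fst‖ ≤ c * ‖Aw‖ := by
      have := (hA w.fst).1
      rw [← le_inv_mul_iff₀ hr] at this
      refine this.trans ?_
      rw [show c * ‖Aw‖ = r⁻¹ * (‖Pi‖ * (‖Aw‖ + ‖E‖ * ‖Aw‖)) by simp only [c]; ring]
      gcongr
    have h3 : ‖w.snd‖ ≤ ‖Aw‖ + ‖K‖ * (c * ‖Aw‖) := by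
      have e : w.snd = D w + K w.fst := by simp [D, fstX]
      rw [e]
      refine (norm_add_le _ _).trans (add_le_add hb ((K.le_opNorm _).trans ?_))
      gcongr
    have h4 : ‖w‖ ≤ ‖w.fst‖ + ‖w.snd‖ := by
      refine le_of_sq_le_sq ?_ (by positivity)
      rw [WithLp.prod_norm_sq_eq_of_L2]
      nlinarith [norm_nonneg w.fst, norm_nonneg w.snd]
    linarith

end System

variable {n : ℕ}

/-! ### Integration by parts for test functions -/

theorem integral_fderiv_eq_zero_of_hasCompactSupport {a : Vec n → ℝ} (ha : ContDiff ℝ ∞ a)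
    (hc : HasCompactSupport a) (v : Vec n) : ∫ x, fderiv ℝ a x v = 0 := by
  have hd : Continuous fun x => fderiv ℝ a x v :=
    (ha.continuous_fderiv (by simp)).clm_apply continuous_const
  have hd' : HasCompactSupport fun x => fderiv ℝ a x v := hc.fderiv_apply ℝ v
  -- Integrate by parts against the constant function `1`; only the products have to be integrable.
  have := integral_mul_fderiv_eq_neg_fderiv_mul_of_integrable (μ := (volume : Measure (Vec n)))
    (f := fun _ => (1 : ℝ)) (g := a) (v := v) (by simp)
    (by simpa using hd.integrable_of_hasCompactSupport hd')
    (by simpa using ha.continuous.integrable_of_hasCompactSupport hc)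
    (by simp) (fun x _ => ha.differentiable (by simp) x)
  simpa using this

/-- Integrating by parts twice exchanges the two directions of differentiation. -/
theorem integral_fderiv_mul_fderiv_comm {a b : Vec n → ℝ} (ha : ContDiff ℝ ∞ a)
    (hb : ContDiff ℝ ∞ b) (hac : HasCompactSupport a) (v w : Vec n) :
    ∫ x, fderiv ℝ a x v * fderiv ℝ b x w = ∫ x, fderiv ℝ a x w * fderiv ℝ b x v := by
  have cd : ∀ {c : Vec n → ℝ}, ContDiff ℝ ∞ c → ∀ v : Vec n,
      ContDiff ℝ ∞ fun x => fderiv ℝ c x v := fun hc v =>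
    (hc.fderiv_right (m := ∞) (by simp)).clm_apply contDiff_const
  have int : ∀ {c d : Vec n → ℝ}, ContDiff ℝ ∞ c → ContDiff ℝ ∞ d → HasCompactSupport c →
      Integrable (fun x => c x * d x) := fun hc hd hcc =>
    (hc.continuous.mul hd.continuous).integrable_of_hasCompactSupport hcc.mul_right
  have parts : ∀ v w : Vec n, ∫ x, fderiv ℝ a x v * fderiv ℝ b x w =
      - ∫ x, a x * fderiv ℝ (fderiv ℝ b) x v w := by
    intro v w
    have := integral_mul_fderiv_eq_neg_fderiv_mul_of_integrable
      (μ := (volume : Measure (Vec n))) (f := a) (g := fun x => fderiv ℝ b x w) (v := v)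
      (int (cd ha v) (cd hb w) (hac.fderiv_apply ℝ v)) (int ha (cd (cd hb w) v) hac)
      (int ha (cd hb w) hac) (fun x _ => ha.differentiable (by simp) x)
      (fun x _ => (cd hb w).differentiable (by simp) x)
    have hx : ∀ x, fderiv ℝ (fun y => fderiv ℝ b y w) x v = fderiv ℝ (fderiv ℝ b) x v w := by
      intro x
      have hx : HasFDerivAt (fderiv ℝ b) (fderiv ℝ (fderiv ℝ b) x) x :=
        ((hb.fderiv_right (m := ∞) (by simp)).differentiable (by simp) x).hasFDerivAt
      rw [(hx.clm_apply (hasFDerivAt_const w x)).fderiv]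
      simp
    simp_rw [hx] at this
    rw [this, neg_neg]
  rw [parts, parts]
  congr! 4 with x
  exact (hb.contDiffAt.isSymmSndFDerivAt
    (by simpa using ENat.LEInfty.out)).eq v w

theorem gradMat_apply {φ : Vec n → Vec n} (hφ : ContDiff ℝ ∞ φ) (x : Vec n) (i j : Fin n) :
    gradMat φ x (i, j) = fderiv ℝ (fun y => φ y i) x (EuclideanSpace.single j 1) := by
  have h1 : HasFDerivAt (fun y => φ y i) ((EuclideanSpace.proj (𝕜 := ℝ) i).comp (fderiv ℝ φ x)) x :=
    (EuclideanSpace.proj (𝕜 := ℝ) i).hasFDerivAt.comp x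
      (hφ.differentiable (by simp) x).hasFDerivAt
  rw [h1.fderiv]
  rfl

theorem contDiff_coord {φ : Vec n → Vec n} (hφ : ContDiff ℝ ∞ φ) (i : Fin n) :
    ContDiff ℝ ∞ fun y => φ y i :=
  (EuclideanSpace.proj (𝕜 := ℝ) i).contDiff.comp hφ

theorem hasCompactSupport_coord {φ : Vec n → Vec n} (hφ : HasCompactSupport φ) (i : Fin n) :
    HasCompactSupport fun y => φ y i :=
  hφ.comp_left (g := fun v : Vec n => v i) rfl

theorem gradMat_eq_zero {Ω : FlowDomain n} {φ : Vec n → Vec n}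
    (hs : tsupport φ ⊆ Ω.carrier) {x : Vec n} (hx : x ∉ Ω.carrier) : gradMat φ x = 0 := by
  have : fderiv ℝ φ x = 0 := by
    by_contra h
    exact hx (hs (tsupport_fderiv_subset ℝ (subset_tsupport _ h)))
  rw [gradMat, this, map_zero]

theorem integral_gradMat_diag {Ω : FlowDomain n} {φ : Vec n → Vec n} (hφ : ContDiff ℝ ∞ φ)
    (hc : HasCompactSupport φ) (hs : tsupport φ ⊆ Ω.carrier) :
    ∫ x in Ω.carrier, ∑ i, gradMat φ x (i, i) = 0 := by
  rw [setIntegral_eq_integral_of_forall_compl_eq_zero fun x hx => by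
    simp [gradMat_eq_zero hs hx]]
  simp_rw [gradMat_apply hφ]
  rw [integral_finsetSum]
  · exact Finset.sum_eq_zero fun i _ => integral_fderiv_eq_zero_of_hasCompactSupport
      (contDiff_coord hφ i) (hasCompactSupport_coord hc i) _
  · intro i _
    exact (((contDiff_coord hφ i).continuous_fderiv (by simp)).clm_apply
      continuous_const).integrable_of_hasCompactSupport
        ((hasCompactSupport_coord hc i).fderiv_apply ℝ _)

/-- `∫ ∂ⱼφᵢ ∂ᵢψⱼ = ∫ ∂ᵢφᵢ ∂ⱼψⱼ`, summed over all `i` and `j`. -/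
theorem integral_gradMat_transpose {Ω : FlowDomain n} {φ ψ : Vec n → Vec n}
    (hφ : ContDiff ℝ ∞ φ) (hφc : HasCompactSupport φ) (hφs : tsupport φ ⊆ Ω.carrier)
    (hψ : ContDiff ℝ ∞ ψ) :
    ∫ x in Ω.carrier, ∑ i, ∑ j, (gradMat φ x (i, j) * gradMat ψ x (j, i)
      - gradMat φ x (i, i) * gradMat ψ x (j, j)) = 0 := by
  rw [setIntegral_eq_integral_of_forall_compl_eq_zero fun x hx => by
    simp [gradMat_eq_zero hφs hx]]
  have int : ∀ i j k l, Integrable fun x => gradMat φ x (i, j) * gradMat ψ x (k, l) := by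
    intro i j k l
    simp_rw [gradMat_apply hφ, gradMat_apply hψ]
    exact ((((contDiff_coord hφ i).continuous_fderiv (by simp)).clm_apply continuous_const).mul
      (((contDiff_coord hψ k).continuous_fderiv (by simp)).clm_apply
        continuous_const)).integrable_of_hasCompactSupport
        ((hasCompactSupport_coord hφc i).fderiv_apply ℝ _).mul_right
  have int' : ∀ i j, Integrable fun x => gradMat φ x (i, j) * gradMat ψ x (j, i)
      - gradMat φ x (i, i) * gradMat ψ x (j, j) := fun i j => (int i j j i).sub (int i i j j)
  rw [integral_finsetSum _ fun i _ => integrable_finsetSum _ fun j _ => int' i j]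
  refine Finset.sum_eq_zero fun i _ => ?_
  rw [integral_finsetSum _ fun j _ => int' i j]
  refine Finset.sum_eq_zero fun j _ => ?_
  rw [integral_sub (int i j j i) (int i i j j), sub_eq_zero]
  simp_rw [gradMat_apply hφ, gradMat_apply hψ]
  exact integral_fderiv_mul_fderiv_comm (contDiff_coord hφ i) (contDiff_coord hψ j)
    (hasCompactSupport_coord hφc i) _ _

/-! ### Divergence and curl on `H₀¹` -/

/-- A closed condition on `H₀¹` holds everywhere if it holds for test functions. -/
theorem H10.induction {Ω : FlowDomain n} {p : H10 Ω → Prop} (hp : IsClosed {u | p u})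
    (h : ∀ u : H10 Ω, (u : WithLp 2 (L2 Ω (Vec n) × L2 Ω (Mat n))) ∈ testPairs Ω → p u)
    (u : H10 Ω) : p u := by
  refine closure_minimal (s := {u : H10 Ω | u.1 ∈ testPairs Ω}) (t := {u | p u})
    h hp
    (closure_subtype.2 (closure_mono ?_ u.2))
  exact fun w hw => ⟨⟨w, subset_closure hw⟩, hw, rfl⟩

theorem divergence_ae (Ω : FlowDomain n) (u : H10 Ω) :
    divergence Ω u =ᵐ[vol Ω] fun x => ∑ i, grad Ω u x (i, i) := by
  filter_upwards [ContinuousLinearMap.coeFn_compLpL (p := 2) (μ := vol Ω)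
    (∑ i : Fin n, EuclideanSpace.proj (𝕜 := ℝ) (i, i) : Mat n →L[ℝ] ℝ) (grad Ω u)] with x hx
  refine hx.trans ?_
  simp 

theorem curl_ae (Ω : FlowDomain n) (u : H10 Ω) :
    curl Ω u =ᵐ[vol Ω] fun x => curlMat n (grad Ω u x) :=
  ContinuousLinearMap.coeFn_compLpL (p := 2) (μ := vol Ω)
    (curlMat n).toContinuousLinearMap (grad Ω u)

theorem divergence_mem_L2modR (Ω : FlowDomain n) (u : H10 Ω) :
    divergence Ω u ∈ (ℝ ∙ (Lp.const 2 (vol Ω) (1 : ℝ)))ᗮ := by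
  refine H10.induction ((Submodule.isClosed_orthogonal _).preimage (divergence Ω).continuous)
    (fun u hu => ?_) u
  refine (mem_L2modR_iff Ω _).2 ?_
  obtain ⟨φ, h1, h2, h3, -, h5⟩ := hu
  rw [← integral_gradMat_diag h1 h2 h3]
  refine integral_congr_ae ?_
  filter_upwards [divergence_ae Ω u, h5] with x hx h
  rw [hx]
  exact congrArg (fun A : Mat n => ∑ i, A (i, i)) h

/-- For `n = 2, 3`, the curl is twice the skew-symmetric part of the gradient. -/
theorem inner_sub_inner_curlMat (hn : n = 2 ∨ n = 3) (A B : Mat n) :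
    inner ℝ A B - inner ℝ (curlMat n A) (curlMat n B) = ∑ i, ∑ j, A (i, j) * B (j, i) := by
  rcases hn with rfl | rfl
  · have : inner ℝ (curlMat 2 A) (curlMat 2 B) =
        (A (1, 0) - A (0, 1)) * (B (1, 0) - B (0, 1)) := by
      rw [PiLp.inner_apply]
      refine (Fin.sum_univ_one _).trans ?_
      simp [curlMat, mul_comm]
    rw [this, PiLp.inner_apply, Fintype.sum_prod_type]
    simp [Fin.sum_univ_two]
    ring
  · have : inner ℝ (curlMat 3 A) (curlMat 3 B) =
        (A (2, 1) - A (1, 2)) * (B (2, 1) - B (1, 2))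
        + (A (0, 2) - A (2, 0)) * (B (0, 2) - B (2, 0))
        + (A (1, 0) - A (0, 1)) * (B (1, 0) - B (0, 1)) := by
      rw [PiLp.inner_apply]
      refine (Fin.sum_univ_three _).trans ?_
      simp [curlMat, mul_comm]
    rw [this, PiLp.inner_apply, Fintype.sum_prod_type]
    simp [Fin.sum_univ_three]
    ring

/-- `∫ ∇u : ∇v = ∫ curl u · curl v + ∫ div u div v` for `u, v ∈ H₀¹(Ω)ⁿ`. -/
theorem inner_grad_eq (hn : n = 2 ∨ n = 3) (Ω : FlowDomain n) (u v : H10 Ω) :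
    inner ℝ (grad Ω u) (grad Ω v) =
      inner ℝ (curl Ω u) (curl Ω v) + inner ℝ (divergence Ω u) (divergence Ω v) := by
  refine H10.induction (p := fun u => inner ℝ (grad Ω u) (grad Ω v) =
      inner ℝ (curl Ω u) (curl Ω v) + inner ℝ (divergence Ω u) (divergence Ω v))
    (isClosed_eq (by fun_prop) (by fun_prop)) (fun u hu => ?_) u
  refine H10.induction (p := fun v => inner ℝ (grad Ω u) (grad Ω v) =
      inner ℝ (curl Ω u) (curl Ω v) + inner ℝ (divergence Ω u) (divergence Ω v))
    (isClosed_eq (by fun_prop) (by fun_prop)) (fun v hv => ?_) v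
  obtain ⟨φ, h1, h2, h3, -, h5⟩ := hu
  obtain ⟨ψ, k1, -, -, -, k5⟩ := hv
  have int : Integrable (fun x => inner ℝ (grad Ω u x) (grad Ω v x)
      - inner ℝ (curl Ω u x) (curl Ω v x)) (vol Ω) :=
    (L2.integrable_inner _ _).sub (L2.integrable_inner _ _)
  rw [← sub_eq_zero, ← sub_sub, L2.inner_def, L2.inner_def, L2.inner_def,
    ← integral_sub (L2.integrable_inner _ _) (L2.integrable_inner _ _),
    ← integral_sub int (L2.integrable_inner _ _), ← integral_gradMat_transpose h1 h2 h3 k1]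
  refine integral_congr_ae ?_
  filter_upwards [divergence_ae Ω u, divergence_ae Ω v, curl_ae Ω u, curl_ae Ω v, h5, k5]
    with x e1 e2 e3 e4 e5 e6
  have e5' : grad Ω u x = gradMat φ x := e5
  have e6' : grad Ω v x = gradMat ψ x := e6
  rw [e1, e2, e3, e4, e5', e6', inner_sub_inner_curlMat hn]
  simp_rw [Finset.sum_sub_distrib, ← Finset.mul_sum, ← Finset.sum_mul]
  simp [mul_comm]

theorem norm_grad_le (Ω : FlowDomain n) (u : H10 Ω) : ‖grad Ω u‖ ≤ ‖u‖ :=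
  WithLp.norm_snd_le _ (u : WithLp 2 (L2 Ω (Vec n) × L2 Ω (Mat n)))

theorem norm_divergence_le (hn : n = 2 ∨ n = 3) (Ω : FlowDomain n) (u : H10 Ω) :
    ‖divergence Ω u‖ ≤ ‖u‖ := by
  refine le_trans (le_of_sq_le_sq ?_ (norm_nonneg _)) (norm_grad_le Ω u)
  have := inner_grad_eq hn Ω u u
  simp only [real_inner_self_eq_norm_sq] at this
  nlinarith [sq_nonneg ‖curl Ω u‖]

theorem norm_divDiv_le (hn : n = 2 ∨ n = 3) (Ω : FlowDomain n) (u : H10 Ω) :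
    ‖divDiv Ω u‖ ≤ ‖divergence Ω u‖ := by
  refine ContinuousLinearMap.opNorm_le_bound _ (norm_nonneg _) fun v => ?_
  refine (norm_inner_le_norm (𝕜 := ℝ) (divergence Ω u) (divergence Ω v)).trans ?_
  gcongr
  exact norm_divergence_le hn Ω v

/-! ### Smoothness of the Navier-Stokes operator -/

theorem convection_apply (Ω : FlowDomain n) (u w v : H10 Ω) :
    convection Ω u w v = ∫ x in Ω.carrier, convDensity Ω u w v x := rfl

theorem isBoundedBilinearMap_convection (Ω : FlowDomain n) :
    IsBoundedBilinearMap ℝ fun p : H10 Ω × H10 Ω => convection Ω p.1 p.2 where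
  add_left u u' w := by
    ext v
    rw [add_apply, convection_apply, convection_apply, convection_apply,
      ← integral_add (integrable_convDensity Ω u w v) (integrable_convDensity Ω u' w v)]
    refine integral_congr_ae ?_
    filter_upwards [Lp.coeFn_add (toL2 Ω u) (toL2 Ω u')] with x hx
    simp only [convDensity, map_add, hx, Pi.add_apply, PiLp.add_apply, add_mul,
      Finset.sum_add_distrib]
  smul_left c u w := by
    ext v
    rw [smul_apply, convection_apply, convection_apply, smul_eq_mul, ← integral_const_mul]
    refine integral_congr_ae ?_
    filter_upwards [Lp.coeFn_smul c (toL2 Ω u)] with x hx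
    simp only [convDensity, map_smul, hx, Pi.smul_apply, PiLp.smul_apply, Finset.mul_sum,
      smul_eq_mul, mul_assoc]
  add_right u w w' := by
    ext v
    rw [add_apply, convection_apply, convection_apply, convection_apply,
      ← integral_add (integrable_convDensity Ω u w v) (integrable_convDensity Ω u w' v)]
    refine integral_congr_ae ?_
    filter_upwards [Lp.coeFn_add (grad Ω w) (grad Ω w')] with x hx
    simp only [convDensity, map_add, hx, Pi.add_apply, PiLp.add_apply, mul_add, add_mul,
      Finset.sum_add_distrib]
  smul_right c u w := by
    ext v
    rw [smul_apply, convection_apply, convection_apply, smul_eq_mul, ← integral_const_mul]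
    refine integral_congr_ae ?_
    filter_upwards [Lp.coeFn_smul c (grad Ω w)] with x hx
    simp only [convDensity, map_smul, hx, Pi.smul_apply, PiLp.smul_apply, Finset.mul_sum,
      smul_eq_mul]
    exact Finset.sum_congr rfl fun i _ => Finset.sum_congr rfl fun j _ => by ring
  bound := by
    obtain ⟨C, hC⟩ := convDensity_bound Ω
    refine ⟨|C| + 1, by positivity, fun u w =>
      ContinuousLinearMap.opNorm_le_bound _ (by positivity) fun v => ?_⟩
    refine (hC u w v).trans ?_
    gcongr
    linarith [le_abs_self C]

theorem contDiff_innerSL_comp {X F V : Type*} [NormedAddCommGroup X] [NormedSpace ℝ X]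
    [NormedAddCommGroup F] [InnerProductSpace ℝ F] [NormedAddCommGroup V] [NormedSpace ℝ V]
    {S : X → F} (hS : ContDiff ℝ 2 S) (T : V →L[ℝ] F) :
    ContDiff ℝ 2 fun x => (innerSL ℝ (S x)).comp T :=
  ((innerDual F).contDiff.comp hS).clm_comp contDiff_const

/-- The shape of the operator `G`, over arbitrary normed spaces. -/
theorem contDiff_quasilinear {X V : Type*} [NormedAddCommGroup X] [NormedSpace ℝ X]
    [NormedAddCommGroup V] [NormedSpace ℝ V] (T : X →L[ℝ] V) {a b c : X → StrongDual ℝ V}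
    (ha : ContDiff ℝ 2 a) (hb : ContDiff ℝ 2 b) (hc : ContDiff ℝ 2 c) (κ : ℝ)
    (f : StrongDual ℝ V) {d : X → StrongDual ℝ X} (hd : ContDiff ℝ 2 d) :
    ContDiff ℝ 2 fun x => (a x - b x + κ • c x - f).comp T + d x :=
  ((((ha.sub hb).add (hc.const_smul κ)).sub contDiff_const).clm_comp contDiff_const).add hd

theorem _root_.IsBoundedBilinearMap.contDiff_diag {X V W : Type*} [NormedAddCommGroup X]
    [NormedSpace ℝ X] [NormedAddCommGroup V] [NormedSpace ℝ V] [NormedAddCommGroup W]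
    [NormedSpace ℝ W] {b : V → V → W} (hb : IsBoundedBilinearMap ℝ fun p : V × V => b p.1 p.2)
    (T : X →L[ℝ] V) : ContDiff ℝ 2 fun x => b (T x) (T x) :=
  hb.contDiff.comp (T.contDiff.prodMk T.contDiff)

set_option maxHeartbeats 1000000 in
theorem contDiff_navierStokes (Ω : FlowDomain n) (ν : ℝ) (f : StrongDual ℝ (H10 Ω))
    (g : L2modR Ω) : ContDiff ℝ 2 (navierStokes Ω ν f g) := by
  have h1 : ContDiff ℝ 2 fun z : VelPres Ω => (innerSL ℝ (grad Ω z.fst)).comp (grad Ω) :=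
    contDiff_innerSL_comp ((grad Ω).comp (velL Ω)).contDiff _
  have h2 : ContDiff ℝ 2 fun z : VelPres Ω =>
      (innerSL ℝ (z.snd : L2 Ω ℝ)).comp (divergence Ω) :=
    contDiff_innerSL_comp (presL Ω).contDiff _
  have h3 : ContDiff ℝ 2 fun z : VelPres Ω => convection Ω z.fst z.fst :=
    (isBoundedBilinearMap_convection Ω).contDiff_diag (velL Ω)
  have h4 : ContDiff ℝ 2 fun z : VelPres Ω =>
      (innerSL ℝ (divergence Ω z.fst - (g : L2 Ω ℝ))).comp (presL Ω) :=
    contDiff_innerSL_comp (((divergence Ω).comp (velL Ω)).contDiff.sub contDiff_const) _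
  exact contDiff_quasilinear (velL Ω) h1 h2 h3 (ν ^ (-(3 / 2) : ℝ)) f h4

/-! ### The first order systems -/

theorem norm_sq_toLp_dual {V F : Type*} [NormedAddCommGroup V] [NormedSpace ℝ V]
    [NormedAddCommGroup F] (a : StrongDual ℝ V) (b : F) :
    ‖(WithLp.toLp 2 (a, b) : WithLp 2 (StrongDual ℝ V × F))‖ ^ 2 = ‖a‖ ^ 2 + ‖b‖ ^ 2 :=
  WithLp.prod_norm_sq_eq_of_L2 _

/-- The norm of a functional on `𝒰` whose pressure part is represented by a function of mean
zero. -/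
theorem norm_sq_velPres_dual {Ω : FlowDomain n} (a : StrongDual ℝ (H10 Ω)) {d : L2 Ω ℝ}
    (hd : d ∈ (ℝ ∙ (Lp.const 2 (vol Ω) (1 : ℝ)))ᗮ) :
    ‖a.comp (velL Ω) + (innerSL ℝ d).comp (presL Ω)‖ ^ 2 = ‖a‖ ^ 2 + ‖d‖ ^ 2 := by
  lift d to L2modR Ω using hd
  have : a.comp (velL Ω) + (innerSL ℝ (d : L2 Ω ℝ)).comp (presL Ω) =
      innerSL ℝ (WithLp.toLp 2 (riesz _ a, d) : VelPres Ω) := by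
    ext w
    have := congrArg (· w.fst) (innerSL_riesz a)
    simp only [innerSL_apply_apply] at this
    simp [WithLp.prod_inner_apply, this]
  rw [this, innerSL_apply_norm, WithLp.prod_norm_sq_eq_of_L2]
  exact congrArg (fun t => t ^ 2 + ‖d‖ ^ 2) ((riesz (H10 Ω)).norm_map a)

/-- The map `θ ↦ ⟪θ, K ·⟫`, i.e. the adjoint of `K` with values in the dual space. -/
def dualAdjoint {X F : Type*} [NormedAddCommGroup X] [NormedSpace ℝ X] [NormedAddCommGroup F]
    [InnerProductSpace ℝ F] (K : X →L[ℝ] F) : F →L[ℝ] StrongDual ℝ X :=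
  (ContinuousLinearMap.precomp ℝ K).comp (innerDual F)

theorem sysGrad_eq_augmented (Ω : FlowDomain n) (ν : ℝ) (f : StrongDual ℝ (H10 Ω))
    (g : L2modR Ω) :
    sysGrad Ω ν f g = augmented (navierStokes Ω ν f g) ((grad Ω).comp (velL Ω))
      (ContinuousLinearEquiv.refl ℝ _) (dualAdjoint ((grad Ω).comp (velL Ω))) := by
  funext y
  refine congrArg (WithLp.toLp 2) (Prod.ext ?_ rfl)
  ext w
  simp [dualAdjoint, momentumGrad, navierStokes]
  ring

theorem sysVort₁_eq_augmented (hn : n = 2 ∨ n = 3) (Ω : FlowDomain n) (ν : ℝ)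
    (f : StrongDual ℝ (H10 Ω)) (g : L2modR Ω) :
    sysVort₁ Ω ν f g = augmented (navierStokes Ω ν f g) ((curl Ω).comp (velL Ω))
      (ContinuousLinearEquiv.refl ℝ _) (dualAdjoint ((curl Ω).comp (velL Ω))) := by
  funext y
  refine congrArg (WithLp.toLp 2) (Prod.ext ?_ rfl)
  ext w
  simp [dualAdjoint, momentumVort, navierStokes, divDiv, inner_grad_eq hn]
  ring

/-- The functional on `𝒰` that sends `(v, q)` to `∫ d div v`, where `d ∈ L₂(Ω)/ℝ` represents the
pressure part `q ↦ b(0, q)` of `b ∈ 𝒰'`. -/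
def presToDiv (Ω : FlowDomain n) : StrongDual ℝ (VelPres Ω) →L[ℝ] StrongDual ℝ (VelPres Ω) :=
  (dualAdjoint ((divergence Ω).comp (velL Ω))).comp
    ((Submodule.subtypeL _).comp
      (((riesz (L2modR Ω)).toContinuousLinearEquiv :
          StrongDual ℝ (L2modR Ω) →L[ℝ] L2modR Ω).comp
        (ContinuousLinearMap.precomp ℝ
          (((WithLp.prodContinuousLinearEquiv 2 ℝ (H10 Ω) (L2modR Ω)).symm :
              H10 Ω × L2modR Ω →L[ℝ] VelPres Ω).comp
            (ContinuousLinearMap.inr ℝ (H10 Ω) (L2modR Ω))))))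

theorem presToDiv_eq {Ω : FlowDomain n} {b : StrongDual ℝ (VelPres Ω)} {d : L2modR Ω}
    (hb : ∀ q : L2modR Ω, b (WithLp.toLp 2 (0, q)) = inner ℝ d q) :
    presToDiv Ω b = (innerSL ℝ (d : L2 Ω ℝ)).comp ((divergence Ω).comp (velL Ω)) := by
  have : b.comp (((WithLp.prodContinuousLinearEquiv 2 ℝ (H10 Ω) (L2modR Ω)).symm :
      H10 Ω × L2modR Ω →L[ℝ] VelPres Ω).comp (ContinuousLinearMap.inr ℝ (H10 Ω) (L2modR Ω))) =
      (riesz (L2modR Ω)).symm d := by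
    ext q
    exact hb q
  simp only [presToDiv, dualAdjoint, ContinuousLinearMap.comp_apply,
    ContinuousLinearMap.precomp_apply, this]
  simp

theorem presToDiv_presToDiv (Ω : FlowDomain n) (b : StrongDual ℝ (VelPres Ω)) :
    presToDiv Ω (presToDiv Ω b) = 0 := by
  rw [presToDiv_eq (d := 0)]
  · simp
  · intro q
    simp [presToDiv, dualAdjoint]

/-- The automorphism `b ↦ b - presToDiv b` of `𝒰'`. It is invertible because `presToDiv` squares
to zero. -/
def subPresToDiv (Ω : FlowDomain n) : StrongDual ℝ (VelPres Ω) ≃L[ℝ] StrongDual ℝ (VelPres Ω) :=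
  ContinuousLinearEquiv.equivOfInverse (ContinuousLinearMap.id ℝ _ - presToDiv Ω)
    (ContinuousLinearMap.id ℝ _ + presToDiv Ω)
    (fun b => by simp [presToDiv_presToDiv]) (fun b => by simp [presToDiv_presToDiv])

/-- For `g = 0`, the pressure part of `G(u,p)` is represented by `div u`, so that `subPresToDiv`
removes the functional `v ↦ ∫ div u div v`. -/
theorem sysVort₂_eq_augmented (hn : n = 2 ∨ n = 3) (Ω : FlowDomain n) (ν : ℝ)
    (f : StrongDual ℝ (H10 Ω)) :
    sysVort₂ Ω ν f = augmented (navierStokes Ω ν f 0) ((curl Ω).comp (velL Ω))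
      (subPresToDiv Ω) (dualAdjoint ((curl Ω).comp (velL Ω))) := by
  funext y
  refine congrArg (WithLp.toLp 2) (Prod.ext ?_ rfl)
  have h := presToDiv_eq (b := navierStokes Ω ν f 0 y.fst)
    (d := ⟨divergence Ω y.fst.fst, divergence_mem_L2modR Ω _⟩)
    (fun q => by simp [navierStokes])
  change _ = navierStokes Ω ν f 0 y.fst - presToDiv Ω (navierStokes Ω ν f 0 y.fst) + _
  rw [h]
  ext w
  simp [dualAdjoint, momentumVort, navierStokes, inner_grad_eq hn]
  ring

theorem lsGrad_eq (Ω : FlowDomain n) (ν : ℝ) (f : StrongDual ℝ (H10 Ω)) (g : L2modR Ω)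
    (y : Trial Ω (Mat n)) : lsGrad Ω ν f g y = 1 / 2 * ‖sysGrad Ω ν f g y‖ ^ 2 := by
  rw [lsGrad, sysGrad, norm_sq_toLp_dual,
    norm_sq_velPres_dual _ (sub_mem (divergence_mem_L2modR Ω _) g.2)]

theorem lsVort₁_eq (Ω : FlowDomain n) (ν : ℝ) (f : StrongDual ℝ (H10 Ω)) (g : L2modR Ω)
    (y : Trial Ω (Vec (2 * n - 3))) :
    lsVort₁ Ω ν f g y = 1 / 2 * ‖sysVort₁ Ω ν f g y‖ ^ 2 := by
  rw [lsVort₁, sysVort₁, norm_sq_toLp_dual,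
    norm_sq_velPres_dual _ (sub_mem (divergence_mem_L2modR Ω _) g.2)]

theorem lsVort₂_eq (Ω : FlowDomain n) (ν : ℝ) (f : StrongDual ℝ (H10 Ω))
    (y : Trial Ω (Vec (2 * n - 3))) :
    lsVort₂ Ω ν f y = 1 / 2 * ‖sysVort₂ Ω ν f y‖ ^ 2 := by
  rw [lsVort₂, sysVort₂, norm_sq_toLp_dual,
    norm_sq_velPres_dual _ (divergence_mem_L2modR Ω _)]

/-- The two momentum residuals differ by `divDiv u`, whose norm is at most `‖div u‖`, a quantity
that both functionals control. -/
theorem lsVort_equiv (hn : n = 2 ∨ n = 3) (Ω : FlowDomain n) (ν : ℝ) (f : StrongDual ℝ (H10 Ω))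
    (y : Trial Ω (Vec (2 * n - 3))) :
    lsVort₁ Ω ν f 0 y ≤ 3 * lsVort₂ Ω ν f y ∧ lsVort₂ Ω ν f y ≤ 3 * lsVort₁ Ω ν f 0 y := by
  have hB := norm_divDiv_le hn Ω y.fst.fst
  have h1 := norm_add_le (momentumVort Ω ν f y) (divDiv Ω y.fst.fst)
  have h2 := norm_sub_le (momentumVort Ω ν f y + divDiv Ω y.fst.fst) (divDiv Ω y.fst.fst)
  rw [add_sub_cancel_right] at h2
  have key : ∀ {s t d : ℝ}, 0 ≤ s → s ≤ t + d → s ^ 2 ≤ 2 * t ^ 2 + 2 * d ^ 2 := by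
    intro s t d hs h
    nlinarith only [hs, h, sq_nonneg (t - d)]
  have e1 := key (norm_nonneg _) (h1.trans (add_le_add le_rfl hB))
  have e2 := key (norm_nonneg _) (h2.trans (add_le_add le_rfl hB))
  have p1 := sq_nonneg ‖momentumVort Ω ν f y‖
  have p2 := sq_nonneg ‖momentumVort Ω ν f y + divDiv Ω y.fst.fst‖
  have p3 := sq_nonneg ‖y.snd - curl Ω y.fst.fst‖
  simp only [lsVort₁, lsVort₂, ZeroMemClass.coe_zero, sub_zero]
  constructor <;> linarith only [e1, e2, p1, p2, p3]

/-- Well-posedness of `G = 0` passes to any first order system of the form `augmented`, and from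
there to its least squares problem. -/
theorem wellPosed_of_augmented {Ω : FlowDomain n} {ν : ℝ} {f : StrongDual ℝ (H10 Ω)}
    {g : L2modR Ω} {F : Type} [NormedAddCommGroup F] [InnerProductSpace ℝ F] [CompleteSpace F]
    {K : VelPres Ω →L[ℝ] L2 Ω F} {P : StrongDual ℝ (VelPres Ω) ≃L[ℝ] StrongDual ℝ (VelPres Ω)}
    {E : L2 Ω F →L[ℝ] StrongDual ℝ (VelPres Ω)} {H : Trial Ω F → Resid Ω F} {Q : Trial Ω F → ℝ}
    (hH : H = augmented (navierStokes Ω ν f g) K P E) (hQ : ∀ y, Q y = 1 / 2 * ‖H y‖ ^ 2)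
    {z : VelPres Ω} (hz : navierStokes Ω ν f g z = 0)
    (hD : IsHomeoOntoRange (fderiv ℝ (navierStokes Ω ν f g) z)) :
    WellPosedAt H (WithLp.toLp 2 (z, K z)) ∧ EquivSqDistNear Q (WithLp.toLp 2 (z, K z)) ∧
      NormalEqWellPosedAt Q (WithLp.toLp 2 (z, K z)) := by
  have hG : WellPosedAt (navierStokes Ω ν f g) z :=
    ⟨hz, (contDiff_navierStokes Ω ν f g).contDiffAt, hD⟩
  have hW : WellPosedAt H (WithLp.toLp 2 (z, K z)) := hH ▸ hG.augmented
  rw [funext hQ]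
  exact ⟨hW, hW.equivSqDistNear, hW.normalEq_dual⟩

end
end NavierStokes

theorem mainTheorem5 (n : ℕ) :
    -- velocity-pressure-velocity gradient formulation, `n ∈ {2, 3, 4}`, arbitrary `g`
    (∀ (Ω : FlowDomain n) (ν : ℝ), 0 < ν →
      ∀ (f : StrongDual ℝ (H10 Ω)) (g : L2modR Ω),
      (∀ y, lsGrad Ω ν f g y = 1 / 2 * ‖sysGrad Ω ν f g y‖ ^ 2) ∧
      (∀ y, sysGrad Ω ν f g y = 0 ↔
        navierStokes Ω ν f g y.fst = 0 ∧ y.snd = grad Ω y.fst.fst) ∧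
      ∀ z : VelPres Ω, navierStokes Ω ν f g z = 0 →
        IsHomeoOntoRange (fderiv ℝ (navierStokes Ω ν f g) z) →
        WellPosedAt (sysGrad Ω ν f g)
          (WithLp.toLp 2 (z, grad Ω z.fst)) ∧
        EquivSqDistNear (lsGrad Ω ν f g)
          (WithLp.toLp 2 (z, grad Ω z.fst)) ∧
        NormalEqWellPosedAt (lsGrad Ω ν f g)
          (WithLp.toLp 2 (z, grad Ω z.fst))) ∧
    -- velocity-pressure-vorticity formulation, `n ∈ {2, 3}`
    (n = 2 ∨ n = 3 →
      -- the system `H₁`, arbitrary `g`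
      (∀ (Ω : FlowDomain n) (ν : ℝ), 0 < ν →
        ∀ (f : StrongDual ℝ (H10 Ω)) (g : L2modR Ω),
        (∀ y, lsVort₁ Ω ν f g y = 1 / 2 * ‖sysVort₁ Ω ν f g y‖ ^ 2) ∧
        (∀ y, sysVort₁ Ω ν f g y = 0 ↔
          navierStokes Ω ν f g y.fst = 0 ∧ y.snd = curl Ω y.fst.fst) ∧
        ∀ z : VelPres Ω, navierStokes Ω ν f g z = 0 →
          IsHomeoOntoRange (fderiv ℝ (navierStokes Ω ν f g) z) →
          WellPosedAt (sysVort₁ Ω ν f g)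
            (WithLp.toLp 2 (z, curl Ω z.fst)) ∧
          EquivSqDistNear (lsVort₁ Ω ν f g)
            (WithLp.toLp 2 (z, curl Ω z.fst)) ∧
          NormalEqWellPosedAt (lsVort₁ Ω ν f g)
            (WithLp.toLp 2 (z, curl Ω z.fst))) ∧
      -- `Q₁ ≂ Q₂` on the whole space, with a constant that depends on `n` only
      (∃ C : ℝ, 0 < C ∧ ∀ (Ω : FlowDomain n) (ν : ℝ), 0 < ν →
        ∀ (f : StrongDual ℝ (H10 Ω)) y,
        lsVort₁ Ω ν f 0 y ≤ C * lsVort₂ Ω ν f y ∧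
        lsVort₂ Ω ν f y ≤ C * lsVort₁ Ω ν f 0 y) ∧
      -- the system `H₂`, with `g = 0`
      (∀ (Ω : FlowDomain n) (ν : ℝ), 0 < ν → ∀ f : StrongDual ℝ (H10 Ω),
        (∀ y, lsVort₂ Ω ν f y = 1 / 2 * ‖sysVort₂ Ω ν f y‖ ^ 2) ∧
        (∀ y, sysVort₂ Ω ν f y = 0 ↔
          navierStokes Ω ν f 0 y.fst = 0 ∧ y.snd = curl Ω y.fst.fst) ∧
        ∀ z : VelPres Ω, navierStokes Ω ν f 0 z = 0 →
          IsHomeoOntoRange (fderiv ℝ (navierStokes Ω ν f 0) z) →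
          WellPosedAt (sysVort₂ Ω ν f)
            (WithLp.toLp 2 (z, curl Ω z.fst)) ∧
          EquivSqDistNear (lsVort₂ Ω ν f)
            (WithLp.toLp 2 (z, curl Ω z.fst)) ∧
          NormalEqWellPosedAt (lsVort₂ Ω ν f)
            (WithLp.toLp 2 (z, curl Ω z.fst)))) := by
  refine ⟨fun Ω ν _ f g => ⟨lsGrad_eq Ω ν f g, fun y => ?_, fun z hz hD =>
    wellPosed_of_augmented (sysGrad_eq_augmented Ω ν f g) (lsGrad_eq Ω ν f g) hz hD⟩,
    fun hn => ⟨fun Ω ν _ f g => ⟨lsVort₁_eq Ω ν f g, fun y => ?_, fun z hz hD =>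
      wellPosed_of_augmented (sysVort₁_eq_augmented hn Ω ν f g) (lsVort₁_eq Ω ν f g) hz hD⟩,
    ⟨3, by norm_num, fun Ω ν _ f y => lsVort_equiv hn Ω ν f y⟩,
    fun Ω ν _ f => ⟨lsVort₂_eq Ω ν f, fun y => ?_, fun z hz hD =>
      wellPosed_of_augmented (sysVort₂_eq_augmented hn Ω ν f) (lsVort₂_eq Ω ν f) hz hD⟩⟩⟩
  · rw [sysGrad_eq_augmented]
    exact augmented_eq_zero
  · rw [sysVort₁_eq_augmented hn]
    exact augmented_eq_zero
  · rw [sysVort₂_eq_augmented hn]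
    exact augmented_eq_zero
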